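/- Let $d_1\le d_2$, and equip $\mathbb R\times\mathbb R^{d}$ and $\mathbb R\times\mathbb R^{d_1\times d_2}$ with the standard inner products $\langle (p,r),(u,w)\rangle = pu+\sum_i r_iw_i$ and $\langle (p,R),(u,W)\rangle = pu+\operatorname{tr}(R^\top W)$. For a cone $K$ with dual cone $K^*=\{r:\langle w,r\rangle\ge 0\ \forall w\in K\}$ and a barrier $f$ on $\operatorname{int}K$, let $f^*(r)=\sup_{w\in\operatorname{int}K}\{-\langle r,w\rangle-f(w)\}$ be the conjugate barrier. The conjugate gradient of $(K,f)$ at $r\in\operatorname{int}K^*$ is the gradient $g^*$ of $f^*$ at $r$; equivalently, $-g^*$ is the unique maximizer in the definition of $f^*(r)$. For the infinity norm cone $K_{\ell_\infty}=\{(u,w)\in\mathbb R\times\mathbb R^{d_1}: u\ge\|w\|_\infty\}$ take the barrier $$f(u,w)=-\sum_{i=1}^{d_1}\log(u^2-w_i^2)+(d_1-1)\log u,$$ and for the spectral norm cone $K_{\mathrm{spec}}=\{(u,W)\in\mathbb R\times\mathbb R^{d_1\times d_2}: u\ge\sigma_{\max}(W)\}$ the barrier $$F(u,W)=-\sum_{i=1}^{d_1}\log(u^2-\sigma_i(W)^2)+(d_1-1)\log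 u,$$ where $\sigma_1(W),\dots,\sigma_{d_1}(W)$ are the singular values of $W$. **Proposition.** Let $(p,R)\in\operatorname{int}(K_{\mathrm{spec}}^*)$ and let $R=U_R\operatorname{Diag}(\sigma_R)V_R^\top$ be a singular value decomposition, with $U_R\in\mathbb R^{d_1\times d_1}$ orthogonal, $V_R\in\mathbb R^{d_2\times d_1}$ with orthonormal columns, and $\sigma_R\in\mathbb R^{d_1}$ nonnegative. Then $(p,\sigma_R)\in\operatorname{int}(K_{\ell_\infty}^*)$, and the conjugate gradient $G^*=(G^*_p,G^*_R)$ of $(K_{\mathrm{spec}},F)$ at $(p,R)$ exists and is $$G^*_p=g^*_p(p,\sigma_R),\qquad G^*_R=U_R\operatorname{Diag}\bigl(g^*_r(p,\sigma_R)\bigr)V_R^\top,$$ where $(g^*_p,g^*_r)=(g^*_p(p,\sigma_R),g^*_r(p,\sigma_R))$ is the conjugate gradient of $(K_{\ell_\infty},f)$ at $(p,\sigma_R)$. It is given explicitly as follows: $g^*_p$ is the unique negative root of $y\mapsto py+\sum_{i=1}^{d_1}\sqrt{1+\sigma_{R,i}^2y^2}+1$, and for every $i$ $$g^*_{r_i}=\frac{\sqrt{1+(g^*_p)^2\sigma_{R,i}^2}-1}{\sigma_{R,i}}\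 \text{ if }\sigma_{R,i}\ne 0,\qquad g^*_{r_i}=0\ \text{ if }\sigma_{R,i}=0.$$ -/

import Mathlib

open Matrix

noncomputable section

namespace ConjGrad

section General

variable {E : Type*} [AddCommGroup E] [Module ℝ E]

/-- The dual cone `K^* = {r : ⟨w, r⟩ ≥ 0 for all w ∈ K}` with respect to the inner product `B`. -/
def dualCone (B : E →ₗ[ℝ] E →ₗ[ℝ] ℝ) (K : Set E) : Set E :=
  {r | ∀ w ∈ K, 0 ≤ B w r}

variable [TopologicalSpace E]

/-- The conjugate barrier `f^*(r) = sup_{w ∈ int K} (-⟨r, w⟩ - f w)`. -/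
def conjugateBarrier (B : E →ₗ[ℝ] E →ₗ[ℝ] ℝ) (K : Set E) (f : E → ℝ) (r : E) : ℝ :=
  sSup ((fun w => -(B r w) - f w) '' interior K)

/-- `g` is the conjugate gradient at `r` of the barrier `f` of the cone `K`: it is the gradient at
`r` of the conjugate barrier (with respect to the inner product `B`), and `-g` is the unique
maximiser over `int K` of `w ↦ -⟨r, w⟩ - f w`. -/
structure IsConjugateGradient [IsTopologicalAddGroup E] [ContinuousSMul ℝ E] [T2Space E]
    [FiniteDimensional ℝ E] (B : E →ₗ[ℝ] E →ₗ[ℝ] ℝ) (K : Set E) (f : E → ℝ) (r g : E) :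
    Prop where
  neg_mem : -g ∈ interior K
  lt_of_ne : ∀ w ∈ interior K, w ≠ -g → -(B r w) - f w < -(B r (-g)) - f (-g)
  hasGradient : HasFDerivAt (conjugateBarrier B K f) (LinearMap.toContinuousLinearMap (B g)) r

end General

/-! ### The infinity norm cone -/

/-- The standard inner product `p u + ∑ i, r i * w i` on `ℝ × ℝ^d`. -/
def vecInner (d : ℕ) : (ℝ × (Fin d → ℝ)) →ₗ[ℝ] (ℝ × (Fin d → ℝ)) →ₗ[ℝ] ℝ :=
  LinearMap.mk₂ ℝ (fun x y => x.1 * y.1 + x.2 ⬝ᵥ y.2)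
    (fun x x' y => by simp [add_dotProduct]; ring)
    (fun c x y => by simp [smul_dotProduct]; ring)
    (fun x y y' => by simp [dotProduct_add]; ring)
    (fun c x y => by simp [dotProduct_smul]; ring)

/-- The epigraph of the infinity norm (the norm of `Fin d → ℝ` is the maximum norm). -/
def infNormCone (d : ℕ) : Set (ℝ × (Fin d → ℝ)) :=
  {x | ‖x.2‖ ≤ x.1}

/-- `f(u, w) = -∑ i, log (u² - w_i²) + (d - 1) log u`. -/
def infNormBarrier (d : ℕ) (x : ℝ × (Fin d → ℝ)) : ℝ :=
  -∑ i, Real.log (x.1 ^ 2 - x.2 i ^ 2) + ((d : ℝ) - 1) * Real.log x.1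

/-! ### The spectral norm cone -/

/-- The inner product `p u + tr (Rᵀ W)` on `ℝ × ℝ^{d₁ × d₂}`. -/
def matInner (d₁ d₂ : ℕ) : (ℝ × Matrix (Fin d₁) (Fin d₂) ℝ) →ₗ[ℝ]
    (ℝ × Matrix (Fin d₁) (Fin d₂) ℝ) →ₗ[ℝ] ℝ :=
  LinearMap.mk₂ ℝ (fun x y => x.1 * y.1 + (x.2ᵀ * y.2).trace)
    (fun x x' y => by simp [Matrix.add_mul]; ring)
    (fun c x y => by simp; ring)
    (fun x y y' => by simp [Matrix.mul_add]; ring)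
    (fun c x y => by simp; ring)

/-- The `i`-th singular value of `W`, counted from `0`, in decreasing order. -/
def singularValue {d₁ d₂ : ℕ} (W : Matrix (Fin d₁) (Fin d₂) ℝ) (i : ℕ) : ℝ :=
  (Matrix.toEuclideanLin W).singularValues i

/-- The epigraph of the spectral norm, i.e. of the largest singular value. -/
def spectralNormCone (d₁ d₂ : ℕ) : Set (ℝ × Matrix (Fin d₁) (Fin d₂) ℝ) :=
  {x | singularValue x.2 0 ≤ x.1}

/-- `F(u, W) = -∑ i, log (u² - σ_i(W)²) + (d₁ - 1) log u`. -/
def spectralNormBarrier (d₁ d₂ : ℕ) (x : ℝ × Matrix (Fin d₁) (Fin d₂) ℝ) : ℝ :=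
  -∑ i : Fin d₁, Real.log (x.1 ^ 2 - singularValue x.2 i ^ 2) + ((d₁ : ℝ) - 1) * Real.log x.1

/-- `R = U Diag(σ) Vᵀ` is a (thin) singular value decomposition of the `d₁ × d₂` matrix `R`:
`U` is orthogonal, `V` has orthonormal columns and `σ` is nonnegative. The entries of `σ` may come
in any order. -/
structure IsSVD {d₁ d₂ : ℕ} (R : Matrix (Fin d₁) (Fin d₂) ℝ) (U : Matrix (Fin d₁) (Fin d₁) ℝ)
    (σ : Fin d₁ → ℝ) (V : Matrix (Fin d₂) (Fin d₁) ℝ) : Prop where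
  orthogonal : Uᵀ * U = 1
  orthonormal : Vᵀ * V = 1
  nonneg : ∀ i, 0 ≤ σ i
  eq : R = U * Matrix.diagonal σ * Vᵀ

end ConjGrad

end

/-!
On the interior of the spectral norm cone, the barrier is
`F (u, W) = -log det (u I - u⁻¹ W Wᵀ) - log u` (`spectralNormBarrier_eq`), which involves no
singular values. The tangent inequality of `log det`, after completing a square in `W / u`, shows
that `F` lies strictly above each of its tangents (`logDetBarrier_support`). This single inequality
has two consequences. `F` is convex (`convexOn_of_support`), and a point at which the gradient of
`F` is `-(p, R)` is the unique maximiser of `-⟨(p, R), ·⟩ - F`. So von Neumann's trace inequality is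
not needed.

It then suffices to exhibit a stationary point. With `R = U Diag(σ) Vᵀ`, the point
`(u, -U Diag(u t) Vᵀ)` has gradient `-(p, R)` as soon as `2 tᵢ / (1 - tᵢ²) = σᵢ u` for every `i`
and `p u = ∑ i, √(1 + σᵢ² u²) + 1` (`logDetGradient_eq`). The first equation is solved explicitly
by `ratio`. The second has a unique positive root, because `p > ∑ i, σ i` in the interior of the
dual cone
(`sum_lt_of_mem_interior_dualCone`, `exists_unique_pos_root`).

The differentiability of the conjugate barrier follows from the uniqueness of the maximiser alone
(`IsConjugateGradient.of_unique_maximizer`): by compactness of a small sphere and convexity, the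
objective grows linearly away from its optimum, so maximisers of nearby problems stay close.

The infinity norm cone needs no separate argument: `(u, w) ↦ (u, Diag w)` turns its barrier and
inner product into those of the spectral norm cone of square matrices.
-/

namespace ConjGrad

/-! ### Convex functions and their conjugates -/

section General

open Filter Topology

/-- A function on a convex set that has an affine minorant touching it at every point is convex.
`L z` is the linear part of the minorant at `z`; it need not depend continuously on `z`. -/
theorem convexOn_of_support {E : Type*} [AddCommGroup E] [Module ℝ E] {s : Set E} (hs : Convex ℝ s)
    {f : E → ℝ} (L : E → E →ₗ[ℝ] ℝ)
    (h : ∀ z ∈ s, ∀ x ∈ s, f z - L z z ≤ f x - L z x) : ConvexOn ℝ s f := by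
  refine ⟨hs, fun x hx y hy a b ha hb hab => ?_⟩
  have hz := hs hx hy ha hb hab
  set z := a • x + b • y with hzdef
  have h1 := mul_le_mul_of_nonneg_left (h z hz x hx) ha
  have h2 := mul_le_mul_of_nonneg_left (h z hz y hy) hb
  have h3 : L z z = a * L z x + b * L z y := by
    conv_lhs => rw [show (L z) z = (L z) (a • x + b • y) from rfl]
    simp
  have h4 : f z - L z z = a * (f z - L z z) + b * (f z - L z z) := by
    rw [← add_mul, hab, one_mul]
  simp only [smul_eq_mul]
  linarith

variable {E : Type*} [NormedAddCommGroup E]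

/-- A set contains a point obtained from an interior point by a small decrease of the
first coordinate. -/
theorem exists_pos_sub_mem_of_mem_interior {s : Set (ℝ × E)} {x : ℝ × E} (hx : x ∈ interior s) :
    ∃ ε > 0, (x.1 - ε, x.2) ∈ s := by
  have hc : Continuous fun ε : ℝ => (x.1 - ε, x.2) := by fun_prop
  have h0 : ∀ᶠ ε in 𝓝 (0 : ℝ), (x.1 - ε, x.2) ∈ s := by
    apply hc.continuousAt.eventually
    simpa using mem_interior_iff_mem_nhds.1 hx
  obtain ⟨ε, h, hε⟩ := ((h0.filter_mono nhdsWithin_le_nhds).and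
    (self_mem_nhdsWithin : Set.Ioi (0 : ℝ) ∈ 𝓝[>] 0)).exists
  exact ⟨ε, hε, h⟩

theorem interior_epigraph_norm :
    interior {x : ℝ × E | ‖x.2‖ ≤ x.1} = {x | ‖x.2‖ < x.1} := by
  apply subset_antisymm
  · intro x hx
    obtain ⟨ε, hε, h⟩ := exists_pos_sub_mem_of_mem_interior hx
    simp only [Set.mem_ofPred_eq] at *
    linarith
  · exact interior_maximal (fun x hx => by
      rw [Set.mem_ofPred_eq] at *
      exact hx.le) (isOpen_lt (by fun_prop) (by fun_prop))

variable [NormedSpace ℝ E]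

theorem convex_epigraph_norm : Convex ℝ {x : ℝ × E | ‖x.2‖ ≤ x.1} := by
  intro x hx y hy a b ha hb _
  simp only [Set.mem_ofPred_eq, Prod.fst_add, Prod.snd_add, Prod.smul_fst, Prod.smul_snd,
    smul_eq_mul] at *
  calc ‖a • x.2 + b • y.2‖ ≤ ‖a • x.2‖ + ‖b • y.2‖ := norm_add_le _ _
    _ = a * ‖x.2‖ + b * ‖y.2‖ := by
      rw [norm_smul, norm_smul, Real.norm_of_nonneg ha, Real.norm_of_nonneg hb]
    _ ≤ _ := by gcongr

variable [FiniteDimensional ℝ E]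

theorem exists_bilin_bound (B : E →ₗ[ℝ] E →ₗ[ℝ] ℝ) :
    ∃ C > 0, ∀ x y, |B x y| ≤ C * ‖x‖ * ‖y‖ := by
  let T : E →L[ℝ] E →L[ℝ] ℝ := LinearMap.toContinuousLinearMap
    ((LinearMap.toContinuousLinearMap (𝕜 := ℝ) (E := E) (F' := ℝ)).toLinearMap ∘ₗ B)
  refine ⟨‖T‖ + 1, by positivity, fun x y => ?_⟩
  calc |B x y| = ‖T x y‖ := rfl
    _ ≤ ‖T‖ * ‖x‖ * ‖y‖ := T.le_opNorm₂ x y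
    _ ≤ _ := by gcongr; linarith

/-- The growth estimate behind the differentiability of the conjugate: a convex function on an
open set with a strict minimum at `z` grows at least linearly away from any small ball around `z`.
-/
theorem exists_linear_growth {s : Set E} (hs : IsOpen s) {h : E → ℝ} (hh : ConvexOn ℝ s h) {z : E}
    (hz : z ∈ s) (hmin : ∀ w ∈ s, w ≠ z → h z < h w) {δ : ℝ} (hδ : 0 < δ)
    (hball : Metric.closedBall z δ ⊆ s) :
    ∃ m > 0, ∀ w ∈ s, δ ≤ ‖w - z‖ → m * ‖w - z‖ ≤ h w - h z := by
  have hcont : ContinuousOn h (Metric.sphere z δ) :=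
    (hh.continuousOn hs).mono (Metric.sphere_subset_closedBall.trans hball)
  obtain ⟨a, ha, hle⟩ := (isCompact_sphere z δ).exists_forall_le' hcont (a := h z) (by
    intro w hw
    refine hmin w (hball (Metric.sphere_subset_closedBall hw)) ?_
    rintro rfl
    simp at hw
    linarith)
  refine ⟨(a - h z) / δ, div_pos (by linarith) hδ, fun w hw hwz => ?_⟩
  have hn : 0 < ‖w - z‖ := hδ.trans_le hwz
  set t := δ / ‖w - z‖ with ht
  have ht0 : 0 < t := div_pos hδ hn
  have ht1 : t ≤ 1 := (div_le_one hn).2 hwz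
  have h1 := hh.2 hz hw (sub_nonneg.2 ht1) ht0.le (by ring)
  have h2 : (1 - t) • z + t • w ∈ Metric.sphere z δ := by
    have : (1 - t) • z + t • w - z = t • (w - z) := by module
    rw [mem_sphere_iff_norm, this, norm_smul, Real.norm_of_nonneg ht0.le, ht]
    field_simp
  have h3 := hle _ h2
  simp only [smul_eq_mul] at h1
  have h4 : a - h z ≤ t * (h w - h z) := by linarith
  calc (a - h z) / δ * ‖w - z‖ = (a - h z) / t := by rw [ht]; field_simp
    _ ≤ h w - h z := by rw [div_le_iff₀ ht0]; linarith

/-- Danskin's principle for the conjugate barrier: a unique maximiser in the definition of the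
conjugate of a convex function determines its gradient. -/
theorem IsConjugateGradient.of_unique_maximizer {B : E →ₗ[ℝ] E →ₗ[ℝ] ℝ}
    (hB : ∀ x y, B x y = B y x) {K : Set E} {f : E → ℝ} {r g : E}
    (hf : ConvexOn ℝ (interior K) f) (hg : -g ∈ interior K)
    (hmax : ∀ w ∈ interior K, w ≠ -g → -(B r w) - f w < -(B r (-g)) - f (-g)) :
    IsConjugateGradient B K f r g := by
  refine ⟨hg, hmax, ?_⟩
  set z := -g with hzdef
  have hgz : g = -z := by simp [hzdef]
  obtain ⟨C, hC, hBC⟩ := exists_bilin_bound B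
  have hh : ConvexOn ℝ (interior K) (fun w => B r w + f w) :=
    ((B r).convexOn hf.1).add hf
  have hval : conjugateBarrier B K f r = -(B r z) - f z := by
    refine IsGreatest.csSup_eq ⟨⟨z, hg, rfl⟩, ?_⟩
    rintro _ ⟨w, hw, rfl⟩
    by_cases hwz : w = z
    · rw [hwz]
    · exact (hmax w hw hwz).le
  rw [hasFDerivAt_iff_isLittleO, Asymptotics.isLittleO_iff]
  intro ε hε
  obtain ⟨δ₀, hδ₀, hball₀⟩ := Metric.nhds_basis_closedBall.mem_iff.1
    (isOpen_interior.mem_nhds hg)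
  set δ := min δ₀ (ε / C) with hδdef
  have hδ : 0 < δ := lt_min hδ₀ (div_pos hε hC)
  have hCδ : C * δ ≤ ε := by
    calc C * δ ≤ C * (ε / C) := by gcongr; exact min_le_right _ _
      _ = ε := by field_simp
  obtain ⟨m, hm, hgrow⟩ := exists_linear_growth isOpen_interior hh hg
    (fun w hw hwz => by have := hmax w hw hwz; linarith) hδ
    ((Metric.closedBall_subset_closedBall (min_le_left _ _)).trans hball₀)
  have hnear : ∀ᶠ r' in 𝓝 r, C * ‖r' - r‖ < m := by
    have hc : Continuous fun r' : E => C * ‖r' - r‖ := by fun_prop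
    exact hc.continuousAt.eventually_lt_const (by simpa using hm)
  filter_upwards [hnear] with r' hr'
  have hsub : ∀ w, B r' w = B r w + B (r' - r) w := fun w => by simp
  -- Near `z` the perturbation `r' - r` costs at most `ε ‖r' - r‖`, since `C δ ≤ ε`; far from `z`
  -- the linear growth of `w ↦ B r w + f w`, with slope `m`, absorbs it.
  have hup : ∀ w ∈ interior K,
      -(B r' w) - f w ≤ -(B r' z) - f z + ε * ‖r' - r‖ := by
    intro w hw
    have hb := neg_le_of_abs_le (hBC (r' - r) (w - z))
    rw [map_sub] at hb
    rw [hsub w, hsub z]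
    have hn := norm_nonneg (r' - r)
    rcases le_total δ ‖w - z‖ with hc | hc
    · have h1 := hgrow w hw hc
      have h2 : C * ‖r' - r‖ * ‖w - z‖ ≤ m * ‖w - z‖ := by gcongr
      have h3 : 0 ≤ ε * ‖r' - r‖ := by positivity
      linarith
    · have h1 : C * ‖r' - r‖ * ‖w - z‖ ≤ ε * ‖r' - r‖ := by
        calc C * ‖r' - r‖ * ‖w - z‖ ≤ C * ‖r' - r‖ * δ := by gcongr
          _ = (C * δ) * ‖r' - r‖ := by ring
          _ ≤ _ := by gcongr
      have h2 : -(B r w) - f w ≤ -(B r z) - f z := by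
        by_cases hwz : w = z
        · rw [hwz]
        · exact (hmax w hw hwz).le
      linarith
  have hle : conjugateBarrier B K f r' ≤ -(B r' z) - f z + ε * ‖r' - r‖ := by
    refine csSup_le ⟨_, z, hg, rfl⟩ ?_
    rintro _ ⟨w, hw, rfl⟩
    exact hup w hw
  have hge : -(B r' z) - f z ≤ conjugateBarrier B K f r' := by
    refine le_csSup ⟨-(B r' z) - f z + ε * ‖r' - r‖, ?_⟩ ⟨z, hg, rfl⟩
    rintro _ ⟨w, hw, rfl⟩
    exact hup w hw
  have hlin : LinearMap.toContinuousLinearMap (B g) (r' - r) = -(B (r' - r) z) := by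
    rw [hgz, LinearMap.coe_toContinuousLinearMap', hB, map_neg]
  rw [hval, hlin, Real.norm_eq_abs, abs_le]
  have := hsub z
  have h3 : 0 ≤ ε * ‖r' - r‖ := by positivity
  constructor <;> linarith

end General

/-! ### The tangent inequality of the log-determinant -/

section LogDet

open scoped Matrix.Norms.L2Operator MatrixOrder

variable {n m : ℕ}

theorem log_det_le_trace_sub {C : Matrix (Fin n) (Fin n) ℝ} (hC : C.PosDef) :
    Real.log C.det ≤ C.trace - n := by
  have h1 : C.det = ∏ i, hC.1.eigenvalues i := by
    simpa using hC.1.det_eq_prod_eigenvalues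
  have h2 : C.trace = ∑ i, hC.1.eigenvalues i := by
    simpa using hC.1.trace_eq_sum_eigenvalues
  rw [h1, h2, Real.log_prod (fun i _ => (hC.eigenvalues_pos i).ne')]
  calc ∑ i, Real.log (hC.1.eigenvalues i) ≤ ∑ i, (hC.1.eigenvalues i - 1) :=
        Finset.sum_le_sum fun i _ => Real.log_le_sub_one_of_pos (hC.eigenvalues_pos i)
    _ = _ := by simp

/-- The concavity of `log det`: its tangent at `A` lies above it. -/
theorem log_det_le {A B : Matrix (Fin n) (Fin n) ℝ} (hA : A.PosDef) (hB : B.PosDef) :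
    Real.log B.det ≤ Real.log A.det + (A⁻¹ * B).trace - n := by
  obtain ⟨S, hS, hAS⟩ := CStarAlgebra.isStrictlyPositive_iff_eq_star_mul_self.mp
    hA.inv.isStrictlyPositive
  -- With `A⁻¹ = Sᴴ S`, apply the case `A = 1` to `S B Sᴴ`.
  have hC : (S * B * Sᴴ).PosDef := by
    have := (Matrix.IsUnit.posDef_star_right_conjugate_iff hS (x := B)).2 hB
    rwa [star_eq_conjTranspose] at this
  have h1 := log_det_le_trace_sub hC
  have hdet : (S * B * Sᴴ).det = A.det⁻¹ * B.det := by
    have : (A⁻¹).det = A.det⁻¹ := by rw [det_nonsing_inv, Ring.inverse_eq_inv]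
    rw [← this, hAS, det_mul, det_mul, det_mul, star_eq_conjTranspose]; ring
  have htr : (S * B * Sᴴ).trace = (A⁻¹ * B).trace := by
    rw [hAS, Matrix.trace_mul_comm, ← Matrix.mul_assoc, star_eq_conjTranspose]
  rw [hdet, htr, Real.log_mul (inv_ne_zero hA.det_pos.ne') hB.det_pos.ne', Real.log_inv] at h1
  linarith

theorem trace_mul_mul_transpose_nonneg {A : Matrix (Fin n) (Fin n) ℝ} (hA : A.PosDef)
    (Y : Matrix (Fin n) (Fin m) ℝ) : 0 ≤ (A * (Y * Yᵀ)).trace := by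
  have := (hA.posSemidef.conjTranspose_mul_mul_same Y).trace_nonneg
  rwa [conjTranspose_eq_transpose_of_trivial, Matrix.mul_assoc, Matrix.trace_mul_comm,
    Matrix.mul_assoc] at this

theorem trace_mul_mul_transpose_pos {A : Matrix (Fin n) (Fin n) ℝ} (hA : A.PosDef)
    {Y : Matrix (Fin n) (Fin m) ℝ} (hY : Y ≠ 0) : 0 < (A * (Y * Yᵀ)).trace := by
  refine (trace_mul_mul_transpose_nonneg hA Y).lt_of_ne' fun h0 => hY ?_
  have hps := hA.posSemidef.conjTranspose_mul_mul_same Y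
  have h1 : Yᴴ * A * Y = 0 := by
    rw [← hps.trace_eq_zero_iff, conjTranspose_eq_transpose_of_trivial, Matrix.mul_assoc,
      Matrix.trace_mul_comm, Matrix.mul_assoc, h0]
  obtain ⟨S, hS, hAS⟩ := CStarAlgebra.isStrictlyPositive_iff_eq_star_mul_self.mp
    hA.isStrictlyPositive
  have h2 : (S * Y)ᴴ * (S * Y) = 0 := by
    rw [conjTranspose_mul, ← h1, hAS, star_eq_conjTranspose]; simp only [Matrix.mul_assoc]
  have h3 : S * Y = 0 := Matrix.conjTranspose_mul_self_eq_zero.1 h2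
  obtain ⟨u, rfl⟩ := hS
  calc Y = ((↑u⁻¹ : Matrix (Fin n) (Fin n) ℝ) * (u : Matrix (Fin n) (Fin n) ℝ)) * Y := by simp
    _ = 0 := by rw [Matrix.mul_assoc, h3, Matrix.mul_zero]

end LogDet

/-! ### The log-determinant barrier -/

section Barrier

variable {n m : ℕ}

/-- The matrix `u I - u⁻¹ W Wᵀ`, which is positive definite exactly when `(u, W)` with `u > 0` is
interior to the spectral norm cone. -/
noncomputable def slack (x : ℝ × Matrix (Fin n) (Fin m) ℝ) : Matrix (Fin n) (Fin n) ℝ :=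
  x.1 • (1 : Matrix (Fin n) (Fin n) ℝ) - x.1⁻¹ • (x.2 * x.2ᵀ)

/-- The function `-log det (u I - u⁻¹ W Wᵀ) - log u`, an expression for the spectral norm barrier
in which no singular values occur. -/
noncomputable def logDetBarrier (x : ℝ × Matrix (Fin n) (Fin m) ℝ) : ℝ :=
  -Real.log (slack x).det - Real.log x.1

/-- The points `(u, W)` with `u > 0` and `u I - u⁻¹ W Wᵀ` positive definite, on which
`logDetBarrier` is given by logarithms of positive numbers. -/
noncomputable def logDetDomain (n m : ℕ) : Set (ℝ × Matrix (Fin n) (Fin m) ℝ) :=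
  {x | 0 < x.1 ∧ (slack x).PosDef}

/-- The gradient of `logDetBarrier` at `(u, W)`, with respect to `matInner`: with
`A = (u I - u⁻¹ W Wᵀ)⁻¹` it is `(-(tr A + tr (A W Wᵀ) / u² + 1 / u), (2 / u) A W)`. -/
noncomputable def logDetGradient (x : ℝ × Matrix (Fin n) (Fin m) ℝ) :
    ℝ × Matrix (Fin n) (Fin m) ℝ :=
  (-((slack x)⁻¹.trace + ((slack x)⁻¹ * (x.2 * x.2ᵀ)).trace / x.1 ^ 2 + x.1⁻¹),
    (2 / x.1) • ((slack x)⁻¹ * x.2))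

theorem matInner_apply (x y : ℝ × Matrix (Fin n) (Fin m) ℝ) :
    matInner n m x y = x.1 * y.1 + (x.2ᵀ * y.2).trace := rfl

theorem matInner_comm (x y : ℝ × Matrix (Fin n) (Fin m) ℝ) :
    matInner n m x y = matInner n m y x := by
  rw [matInner_apply, matInner_apply, mul_comm x.1, ← Matrix.trace_transpose (x.2ᵀ * y.2)]
  simp

/-- Completing the square: the trace of `A` times `slack x` is linear in `x = (u, W)`, up to the
term `-u tr (A Y Yᵀ)` with `Y = W / u - z.2 / z.1`, which is nonpositive for positive definite `A`. -/
theorem trace_mul_slack {A : Matrix (Fin n) (Fin n) ℝ} (hA : Aᵀ = A)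
    {z x : ℝ × Matrix (Fin n) (Fin m) ℝ} (hz : 0 < z.1) (hx : 0 < x.1) :
    (A * slack x).trace = x.1 * A.trace
      - x.1 * (A * ((x.1⁻¹ • x.2 - z.1⁻¹ • z.2) * (x.1⁻¹ • x.2 - z.1⁻¹ • z.2)ᵀ)).trace
      - 2 / z.1 * (A * (x.2 * z.2ᵀ)).trace + x.1 / z.1 ^ 2 * (A * (z.2 * z.2ᵀ)).trace := by
  have hsymm : (A * (z.2 * x.2ᵀ)).trace = (A * (x.2 * z.2ᵀ)).trace := by
    rw [← Matrix.trace_transpose, transpose_mul, transpose_mul, transpose_transpose, hA,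
      Matrix.trace_mul_comm]
  simp only [slack, transpose_sub, transpose_smul, Matrix.mul_sub, Matrix.sub_mul,
    Matrix.mul_smul, Matrix.smul_mul, trace_sub, trace_smul, smul_eq_mul, Matrix.mul_one, hsymm]
  field_simp
  ring

/-- The tangent of `logDetBarrier` at any point `z` of the domain lies below it, and touches it at
`z` only. The inequality combines the tangent inequalities of `log det` and `log` with the
completed square of `trace_mul_slack`. -/
theorem logDetBarrier_support {z x : ℝ × Matrix (Fin n) (Fin m) ℝ} (hz : z ∈ logDetDomain n m)
    (hx : x ∈ logDetDomain n m) :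
    logDetBarrier z - matInner n m (logDetGradient z) z ≤
      logDetBarrier x - matInner n m (logDetGradient z) x ∧
    (x ≠ z → logDetBarrier z - matInner n m (logDetGradient z) z <
      logDetBarrier x - matInner n m (logDetGradient z) x) := by
  obtain ⟨hz0, hzA⟩ := hz
  obtain ⟨hx0, hxA⟩ := hx
  set A := (slack z)⁻¹ with hAdef
  have hA : A.PosDef := hzA.inv
  have hAt : Aᵀ = A := by
    rw [← conjTranspose_eq_transpose_of_trivial]; exact hA.1
  set Y := x.1⁻¹ • x.2 - z.1⁻¹ • z.2 with hY
  have h1 := log_det_le hzA hxA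
  rw [← hAdef, trace_mul_slack hAt hz0 hx0, ← hY] at h1
  have h2 : (A * slack z).trace = n := by
    rw [hAdef, Matrix.nonsing_inv_mul _ hzA.det_pos.ne'.isUnit]; simp
  rw [trace_mul_slack hAt hz0 hz0, sub_self, Matrix.zero_mul, Matrix.mul_zero, trace_zero] at h2
  have hM : ∀ w : Matrix (Fin n) (Fin m) ℝ,
      (((2 / z.1) • (A * z.2))ᵀ * w).trace = 2 / z.1 * (A * (w * z.2ᵀ)).trace := by
    intro w
    rw [transpose_smul, Matrix.smul_mul, trace_smul, smul_eq_mul, transpose_mul, hAt,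
      Matrix.trace_mul_comm, ← Matrix.mul_assoc, Matrix.trace_mul_comm]
  simp only [matInner_apply, logDetGradient, logDetBarrier, ← hAdef, hM]
  have hlog : Real.log x.1 ≤ Real.log z.1 + x.1 / z.1 - 1 := by
    have := Real.log_le_sub_one_of_pos (div_pos hx0 hz0)
    rw [Real.log_div hx0.ne' hz0.ne'] at this
    linarith
  have hzz : (A * (z.2 * z.2ᵀ)).trace / z.1 ^ 2 * z.1 = (A * (z.2 * z.2ᵀ)).trace / z.1 := by
    field_simp
  have hzz' : z.1 / z.1 ^ 2 * (A * (z.2 * z.2ᵀ)).trace = (A * (z.2 * z.2ᵀ)).trace / z.1 := by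
    field_simp
  have hzi : z.1⁻¹ * z.1 = 1 := inv_mul_cancel₀ hz0.ne'
  have hxi : z.1⁻¹ * x.1 = x.1 / z.1 := by ring
  have hxx : (A * (z.2 * z.2ᵀ)).trace / z.1 ^ 2 * x.1 =
    x.1 / z.1 ^ 2 * (A * (z.2 * z.2ᵀ)).trace := by ring
  have hQ : 0 ≤ x.1 * (A * (Y * Yᵀ)).trace :=
    mul_nonneg hx0.le (trace_mul_mul_transpose_nonneg hA Y)
  simp only [neg_mul, add_mul, hzz, hzi, hxi, hxx]
  rw [hzz'] at h2
  refine ⟨by linarith, fun hne => ?_⟩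
  -- For `x.1 = z.1` the completed square is strict, for `x.1 ≠ z.1` the tangent of `log` is.
  by_cases hu : x.1 = z.1
  · have hYne : Y ≠ 0 := by
      intro h0
      apply hne
      refine Prod.ext hu ?_
      rw [hY, hu, ← smul_sub, smul_eq_zero] at h0
      exact sub_eq_zero.1 (h0.resolve_left (inv_ne_zero hz0.ne'))
    have hQ' : 0 < x.1 * (A * (Y * Yᵀ)).trace :=
      mul_pos hx0 (trace_mul_mul_transpose_pos hA hYne)
    linarith
  · have hlog' : Real.log x.1 < Real.log z.1 + x.1 / z.1 - 1 := by
      have := Real.log_lt_sub_one_of_pos (div_pos hx0 hz0)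
        (by rwa [ne_eq, div_eq_one_iff_eq hz0.ne'])
      rw [Real.log_div hx0.ne' hz0.ne'] at this
      linarith
    linarith

end Barrier

/-! ### Singular values -/

section SingularValues

open scoped Matrix.Norms.L2Operator

variable {n m : ℕ}

theorem norm_toEuclideanLin_le (W : Matrix (Fin n) (Fin m) ℝ) (x : EuclideanSpace ℝ (Fin m)) :
    ‖toEuclideanLin W x‖ ≤ ‖W‖ * ‖x‖ := by
  exact l2_opNorm_mulVec W x

theorem inner_adjoint_comp_self (T : EuclideanSpace ℝ (Fin m) →ₗ[ℝ] EuclideanSpace ℝ (Fin n))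
    (x : EuclideanSpace ℝ (Fin m)) :
    inner ℝ ((T.adjoint ∘ₗ T) x) x = ‖T x‖ ^ 2 := by
  rw [LinearMap.comp_apply, LinearMap.adjoint_inner_left, real_inner_self_eq_norm_sq]

theorem norm_le_of_singularValue_zero_le {W : Matrix (Fin n) (Fin m) ℝ} {c : ℝ}
    (h : singularValue W 0 ≤ c) : ‖W‖ ≤ c := by
  set T := toEuclideanLin W with hT
  have hc : 0 ≤ c := (T.singularValues_nonneg 0).trans h
  rw [l2_opNorm_def]
  refine ContinuousLinearMap.opNorm_le_bound _ hc fun x => ?_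
  change ‖T x‖ ≤ c * ‖x‖
  refine le_of_sq_le_sq ?_ (by positivity)
  have hfr : Module.finrank ℝ (EuclideanSpace ℝ (Fin m)) = m := by simp
  have hS := T.isSymmetric_adjoint_comp_self
  set b := hS.eigenvectorBasis hfr with hb
  rw [← inner_adjoint_comp_self, mul_pow, ← b.sum_sq_norm_inner_right x, Finset.mul_sum,
    ← b.sum_inner_mul_inner]
  refine Finset.sum_le_sum fun i _ => ?_
  have h1 : inner ℝ ((T.adjoint ∘ₗ T) x) (b i) = T.singularValues i ^ 2 * inner ℝ (b i) x := by
    rw [hS, hb, hS.apply_eigenvectorBasis, inner_smul_right, T.sq_singularValues_fin hfr,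
      real_inner_comm]
    rfl
  have h2 : T.singularValues i ≤ c := (T.singularValues_antitone (Nat.zero_le i)).trans h
  rw [h1, Real.norm_eq_abs, sq_abs, mul_assoc, ← sq]
  have := T.singularValues_nonneg i
  gcongr

theorem singularValue_le_norm (W : Matrix (Fin n) (Fin m) ℝ) (i : ℕ) :
    singularValue W i ≤ ‖W‖ := by
  set T := toEuclideanLin W with hT
  have hfr : Module.finrank ℝ (EuclideanSpace ℝ (Fin m)) = m := by simp
  rcases lt_or_ge i m with hi | hi
  · have hS := T.isSymmetric_adjoint_comp_self
    have h1 := inner_adjoint_comp_self T (hS.eigenvectorBasis hfr ⟨i, hi⟩)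
    rw [hS.apply_eigenvectorBasis, inner_smul_left, real_inner_self_eq_norm_sq,
      OrthonormalBasis.norm_eq_one, ← T.sq_singularValues_of_lt hfr hi] at h1
    have h2 := norm_toEuclideanLin_le W (hS.eigenvectorBasis hfr ⟨i, hi⟩)
    rw [OrthonormalBasis.norm_eq_one, mul_one] at h2
    have h3 : T.singularValues i = ‖T (hS.eigenvectorBasis hfr ⟨i, hi⟩)‖ := by
      rw [← sq_eq_sq₀ (T.singularValues_nonneg i) (norm_nonneg _)]
      simpa using h1
    calc singularValue W i = T.singularValues i := rfl
      _ ≤ ‖W‖ := h3 ▸ h2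
  · calc singularValue W i = 0 := LinearMap.singularValues_of_finrank_le _ (hfr.trans_le hi)
      _ ≤ ‖W‖ := norm_nonneg W

theorem spectralNormCone_eq : spectralNormCone n m = {x | ‖x.2‖ ≤ x.1} := by
  ext x
  exact ⟨norm_le_of_singularValue_zero_le, (singularValue_le_norm x.2 0).trans⟩

theorem interior_spectralNormCone : interior (spectralNormCone n m) = {x | ‖x.2‖ < x.1} := by
  rw [spectralNormCone_eq]
  exact interior_epigraph_norm

theorem slack_posDef {x : ℝ × Matrix (Fin n) (Fin m) ℝ} (hx : ‖x.2‖ < x.1) :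
    (slack x).PosDef := by
  have hx0 : 0 < x.1 := (norm_nonneg _).trans_lt hx
  refine PosDef.of_dotProduct_mulVec_pos ?_ fun v hv => ?_
  · simp [IsHermitian, slack, conjTranspose_eq_transpose_of_trivial]
  · have h1 : star v ⬝ᵥ slack x *ᵥ v = x.1 * (v ⬝ᵥ v) - x.1⁻¹ * ((x.2ᵀ *ᵥ v) ⬝ᵥ (x.2ᵀ *ᵥ v)) := by
      simp only [slack, star_trivial, sub_mulVec, smul_mulVec, one_mulVec, dotProduct_sub,
        dotProduct_smul, smul_eq_mul]
      rw [← mulVec_mulVec, dotProduct_mulVec, ← mulVec_transpose]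
    have hd : ∀ (k : ℕ) (w : Fin k → ℝ), w ⬝ᵥ w = ‖WithLp.toLp 2 w‖ ^ 2 := by
      intro k w
      rw [EuclideanSpace.real_norm_sq_eq]
      simp [dotProduct, sq]
    have h2 := l2_opNorm_mulVec x.2ᵀ (WithLp.toLp 2 v)
    have h3 : ‖x.2ᵀ‖ = ‖x.2‖ := by
      rw [← conjTranspose_eq_transpose_of_trivial, l2_opNorm_conjTranspose]
    have hv0 : 0 < ‖WithLp.toLp 2 v‖ := norm_pos_iff.2 (by simpa using hv)
    rw [h3] at h2
    have h4 : ‖WithLp.toLp 2 (x.2ᵀ *ᵥ v)‖ < x.1 * ‖WithLp.toLp 2 v‖ :=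
      h2.trans_lt (by gcongr)
    rw [h1, hd, hd, sub_pos]
    calc x.1⁻¹ * ‖WithLp.toLp 2 (x.2ᵀ *ᵥ v)‖ ^ 2
        < x.1⁻¹ * (x.1 * ‖WithLp.toLp 2 v‖) ^ 2 := by gcongr
      _ = _ := by field_simp

theorem mem_logDetDomain {x : ℝ × Matrix (Fin n) (Fin m) ℝ} (hx : ‖x.2‖ < x.1) :
    x ∈ logDetDomain n m :=
  ⟨(norm_nonneg _).trans_lt hx, slack_posDef hx⟩

theorem charpoly_transpose_mul_self (W : Matrix (Fin n) (Fin m) ℝ) :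
    (Wᵀ * W).charpoly =
      ∏ i : Fin m, (Polynomial.X - Polynomial.C (singularValue W i ^ 2)) := by
  set T := toEuclideanLin W with hT
  have hfr : Module.finrank ℝ (EuclideanSpace ℝ (Fin m)) = m := by simp
  have h1 : toEuclideanLin (Wᵀ * W) = T.adjoint ∘ₗ T := by
    rw [hT, ← toEuclideanLin_conjTranspose_eq_adjoint, conjTranspose_eq_transpose_of_trivial]
    ext v i
    simp [toLpLin_apply, mulVec_mulVec]
  have h2 : (toEuclideanLin (Wᵀ * W)).charpoly = (Wᵀ * W).charpoly := by
    rw [toEuclideanLin_eq_toLin_orthonormal, charpoly_toLin]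
  rw [← h2, h1, T.isSymmetric_adjoint_comp_self.charpoly_eq hfr]
  refine Finset.prod_congr rfl fun i _ => ?_
  rw [← T.sq_singularValues_fin hfr]
  rfl

/-- The singular values are defined through `Wᵀ W`, of size `m`. For `n ≤ m` its characteristic
polynomial is `X ^ (m - n)` times that of `W Wᵀ`, and the singular values from the `n`-th on
vanish. -/
theorem charpoly_mul_transpose_self (h : n ≤ m) (W : Matrix (Fin n) (Fin m) ℝ) :
    (W * Wᵀ).charpoly =
      ∏ i : Fin n, (Polynomial.X - Polynomial.C (singularValue W i ^ 2)) := by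
  have h1 := charpoly_mul_comm_of_le Wᵀ W (by simpa using h)
  rw [charpoly_transpose_mul_self, Fintype.card_fin, Fintype.card_fin] at h1
  obtain ⟨k, rfl⟩ := Nat.exists_eq_add_of_le h
  rw [Fin.prod_univ_add, Nat.add_sub_cancel_left] at h1
  have h2 : ∀ i : Fin k, singularValue W (Fin.natAdd n i) = 0 := by
    intro i
    refine (LinearMap.singularValues_eq_zero_iff_le_finrank_range _).2 ?_
    calc _ ≤ Module.finrank ℝ (EuclideanSpace ℝ (Fin n)) := Submodule.finrank_le _
      _ ≤ _ := by simp
  simp only [h2, Fin.val_castAdd, ne_eq, OfNat.ofNat_ne_zero, not_false_eq_true, zero_pow, map_zero,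
    sub_zero, Finset.prod_const, Finset.card_univ, Fintype.card_fin] at h1
  rw [mul_comm] at h1
  exact (mul_left_cancel₀ (pow_ne_zero _ Polynomial.X_ne_zero) h1).symm

theorem det_slack (h : n ≤ m) {x : ℝ × Matrix (Fin n) (Fin m) ℝ} (hx : 0 < x.1) :
    (slack x).det = x.1⁻¹ ^ n * ∏ i : Fin n, (x.1 ^ 2 - singularValue x.2 i ^ 2) := by
  have h1 : slack x = x.1⁻¹ • (scalar (Fin n) (x.1 ^ 2) - x.2 * x.2ᵀ) := by
    rw [slack, smul_sub, scalar_apply, ← smul_one_eq_diagonal, smul_smul]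
    congr 2
    field_simp
  rw [h1, det_smul, ← eval_charpoly, charpoly_mul_transpose_self h, Polynomial.eval_prod]
  simp

theorem spectralNormBarrier_eq (h : n ≤ m) {x : ℝ × Matrix (Fin n) (Fin m) ℝ}
    (hx : ‖x.2‖ < x.1) : spectralNormBarrier n m x = logDetBarrier x := by
  have hx0 : 0 < x.1 := (norm_nonneg _).trans_lt hx
  have hne : ∀ i : Fin n, x.1 ^ 2 - singularValue x.2 i ^ 2 ≠ 0 := by
    intro i
    have h0 : 0 ≤ singularValue x.2 i := LinearMap.singularValues_nonneg _ _
    have h1 := (singularValue_le_norm x.2 i).trans_lt hx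
    have : singularValue x.2 i ^ 2 < x.1 ^ 2 := by gcongr
    linarith
  rw [logDetBarrier, det_slack h hx0, Real.log_mul (by positivity)
    (Finset.prod_ne_zero_iff.2 fun i _ => hne i), Real.log_prod fun i _ => hne i, Real.log_pow,
    Real.log_inv, spectralNormBarrier]
  ring

end SingularValues

/-! ### The scalar equations -/

section Scalar

variable {n : ℕ} {σ : Fin n → ℝ} {p : ℝ}

theorem sqrt_one_add_sq_sub_le {s u v : ℝ} (hs : 0 ≤ s) (huv : u ≤ v) :
    √(1 + s ^ 2 * v ^ 2) - √(1 + s ^ 2 * u ^ 2) ≤ s * (v - u) := by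
  have h1 : 0 ≤ s * (v - u) := mul_nonneg hs (sub_nonneg.2 huv)
  have h2 : s * u ≤ √(1 + s ^ 2 * u ^ 2) := by
    apply Real.le_sqrt_of_sq_le; nlinarith
  have h3 : √(1 + s ^ 2 * v ^ 2) ≤ √(1 + s ^ 2 * u ^ 2) + s * (v - u) := by
    apply Real.sqrt_le_iff.2 ⟨by positivity, ?_⟩
    have h4 := Real.sq_sqrt (show 0 ≤ 1 + s ^ 2 * u ^ 2 by positivity)
    have h5 := mul_le_mul_of_nonneg_right h2 h1
    nlinarith
  linarith

/-- The left side of the equation has derivative at least `p - ∑ i, σ i > 0` on `u ≥ 0` and is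
negative at `0`. -/
theorem exists_unique_pos_root (hσ : ∀ i, 0 ≤ σ i) (hp : ∑ i, σ i < p) :
    ∃ u > 0, p * u - ∑ i, √(1 + σ i ^ 2 * u ^ 2) - 1 = 0 ∧
      ∀ v > 0, p * v - ∑ i, √(1 + σ i ^ 2 * v ^ 2) - 1 = 0 → v = u := by
  set ψ : ℝ → ℝ := fun u => p * u - ∑ i, √(1 + σ i ^ 2 * u ^ 2) - 1 with hψ
  have hmono : ∀ u v, u ≤ v → (p - ∑ i, σ i) * (v - u) ≤ ψ v - ψ u := by
    intro u v huv
    have := Finset.sum_le_sum fun i (_ : i ∈ Finset.univ) => sqrt_one_add_sq_sub_le (hσ i) huv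
    rw [Finset.sum_sub_distrib, ← Finset.sum_mul] at this
    simp only [hψ]
    linarith
  have hc : 0 < p - ∑ i, σ i := sub_pos.2 hp
  have h0 : ψ 0 = -(n + 1) := by simp [hψ]; ring
  -- The slope bound carries `ψ` from `ψ 0 = -(n + 1)` to a nonnegative value at `M`.
  set M := ((n : ℝ) + 1) / (p - ∑ i, σ i) with hM
  have hM0 : 0 ≤ M := by positivity
  have hMψ : 0 ≤ ψ M := by
    have h1 := hmono 0 M hM0
    have h2 : (p - ∑ i, σ i) * (M - 0) = n + 1 := by rw [hM]; field_simp; ring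
    linarith
  have hcont : ContinuousOn ψ (Set.Icc 0 M) := by
    apply Continuous.continuousOn; simp only [hψ]; fun_prop
  have hn : (0 : ℝ) ≤ n := Nat.cast_nonneg n
  obtain ⟨u, hu, hψu⟩ := intermediate_value_Icc hM0 hcont
    (show (0 : ℝ) ∈ Set.Icc (ψ 0) (ψ M) from ⟨by linarith, hMψ⟩)
  have hu0 : 0 < u := by
    refine hu.1.lt_of_ne fun h => ?_
    rw [← h] at hψu
    linarith
  refine ⟨u, hu0, hψu, fun v hv hψv => ?_⟩
  have hψv' : ψ v = 0 := hψv
  rcases lt_trichotomy v u with h | h | h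
  · have := hmono v u h.le
    have := mul_pos hc (sub_pos.2 h)
    linarith
  · exact h
  · have := hmono u v h.le
    have := mul_pos hc (sub_pos.2 h)
    linarith

/-- The solution `t ∈ (-1, 1)` of `2 t / (1 - t²) = s u`. At the maximiser of `-⟨r, ·⟩ - f` with
first coordinate `u`, the coordinate belonging to `s` is `-u t`. The form
`s u / (1 + √(1 + s² u²))` covers `s = 0` as well. -/
noncomputable def ratio (u s : ℝ) : ℝ := s * u / (1 + √(1 + s ^ 2 * u ^ 2))

variable {u s : ℝ}

theorem ratio_nonneg (hu : 0 < u) (hs : 0 ≤ s) : 0 ≤ ratio u s := by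
  unfold ratio; positivity

theorem ratio_lt_one (u s : ℝ) : ratio u s < 1 := by
  rw [ratio, div_lt_one (by positivity)]
  have : s * u ≤ √(1 + s ^ 2 * u ^ 2) := by
    apply Real.le_sqrt_of_sq_le; nlinarith
  linarith

theorem mul_ratio (hs : s ≠ 0) : u * ratio u s = (√(1 + u ^ 2 * s ^ 2) - 1) / s := by
  have h := Real.sq_sqrt (show 0 ≤ 1 + u ^ 2 * s ^ 2 by positivity)
  rw [ratio, mul_comm (s ^ 2)]
  have : 0 < 1 + √(1 + u ^ 2 * s ^ 2) := by positivity
  field_simp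
  nlinarith

theorem one_sub_ratio_sq (u s : ℝ) :
    1 - ratio u s ^ 2 = 2 / (1 + √(1 + s ^ 2 * u ^ 2)) := by
  have h := Real.sq_sqrt (show 0 ≤ 1 + s ^ 2 * u ^ 2 by positivity)
  have : 0 < 1 + √(1 + s ^ 2 * u ^ 2) := by positivity
  rw [ratio]
  field_simp
  nlinarith

theorem two_mul_ratio_div (u s : ℝ) : 2 * ratio u s / (1 - ratio u s ^ 2) = s * u := by
  rw [one_sub_ratio_sq]
  have : 0 < 1 + √(1 + s ^ 2 * u ^ 2) := by positivity
  rw [ratio]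
  field_simp

theorem one_add_ratio_sq_div (u s : ℝ) :
    (1 + ratio u s ^ 2) / (1 - ratio u s ^ 2) = √(1 + s ^ 2 * u ^ 2) := by
  have h1 : 1 + ratio u s ^ 2 = 2 - (1 - ratio u s ^ 2) := by ring
  have : 0 < 1 + √(1 + s ^ 2 * u ^ 2) := by positivity
  rw [h1, one_sub_ratio_sq]
  field_simp
  ring

end Scalar

/-! ### The gradient at the maximiser -/

section Gradient

open scoped Matrix.Norms.L2Operator

variable {n m : ℕ}

theorem trace_mul_diagonal_mul_transpose {U : Matrix (Fin n) (Fin n) ℝ} (hU : Uᵀ * U = 1)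
    (a : Fin n → ℝ) : (U * diagonal a * Uᵀ).trace = ∑ i, a i := by
  rw [Matrix.trace_mul_comm, ← Matrix.mul_assoc, hU, Matrix.one_mul, trace_diagonal]

theorem norm_mul_diagonal_mul_transpose_le {U : Matrix (Fin n) (Fin n) ℝ} (hU : Uᵀ * U = 1)
    {V : Matrix (Fin m) (Fin n) ℝ} (hV : Vᵀ * V = 1) (a : Fin n → ℝ) :
    ‖U * diagonal a * Vᵀ‖ ≤ ‖a‖ := by
  have key : ∀ {k : ℕ} {A : Matrix (Fin k) (Fin n) ℝ}, Aᵀ * A = 1 → ‖A‖ ≤ 1 := by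
    intro k A hA
    have h1 := l2_opNorm_conjTranspose_mul_self A
    rw [conjTranspose_eq_transpose_of_trivial, hA, ← diagonal_one, l2_opNorm_diagonal] at h1
    have h2 : ‖(1 : Fin n → ℝ)‖ ≤ 1 := by
      rw [pi_norm_le_iff_of_nonneg zero_le_one]; simp
    have h1' : ‖(1 : Fin n → ℝ)‖ = ‖A‖ * ‖A‖ := h1
    nlinarith [norm_nonneg A]
  have hVt : ‖Vᵀ‖ = ‖V‖ := by
    rw [← conjTranspose_eq_transpose_of_trivial, l2_opNorm_conjTranspose]
  calc ‖U * diagonal a * Vᵀ‖ ≤ ‖U‖ * ‖diagonal a‖ * ‖Vᵀ‖ :=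
        (l2_opNorm_mul _ _).trans (by gcongr; exact l2_opNorm_mul _ _)
    _ ≤ 1 * ‖a‖ * 1 := by
        rw [hVt, l2_opNorm_diagonal]
        gcongr
        · exact key hU
        · exact key hV
    _ = _ := by ring

/-- Stationarity of `-⟨(p, R), ·⟩ - logDetBarrier` at the claimed maximiser. The singular vectors
of `R` diagonalise everything; the matrix part is the equation `2 t / (1 - t²) = σ u` for each
singular value, and the first coordinate is the equation for the root. -/
theorem logDetGradient_eq {p : ℝ} {R : Matrix (Fin n) (Fin m) ℝ}
    {U : Matrix (Fin n) (Fin n) ℝ} {σ : Fin n → ℝ} {V : Matrix (Fin m) (Fin n) ℝ}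
    (hsvd : IsSVD R U σ V) {u : ℝ} (hu : 0 < u)
    (hroot : p * u - ∑ i, √(1 + σ i ^ 2 * u ^ 2) - 1 = 0) :
    logDetGradient (u, -(U * diagonal (fun i => u * ratio u (σ i)) * Vᵀ)) = (-p, -R) := by
  obtain ⟨hU, hV, hσ, hR⟩ := hsvd
  have hU' : U * Uᵀ = 1 := mul_eq_one_comm.1 hU
  set t : Fin n → ℝ := fun i => ratio u (σ i) with ht
  have hden : ∀ i, 0 < 1 - t i ^ 2 := fun i => by
    rw [ht]; simp only [one_sub_ratio_sq]; positivity
  set D := diagonal (fun i => u * t i) with hD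
  have hWW : -(U * D * Vᵀ) * (-(U * D * Vᵀ))ᵀ = U * diagonal (fun i => (u * t i) ^ 2) * Uᵀ := by
    calc _ = U * D * (Vᵀ * V) * Dᵀ * Uᵀ := by
          simp only [transpose_neg, transpose_mul, transpose_transpose, Matrix.neg_mul,
            Matrix.mul_neg, neg_neg, Matrix.mul_assoc]
      _ = _ := by
          rw [hV, Matrix.mul_one, hD, diagonal_transpose, Matrix.mul_assoc U, diagonal_mul_diagonal]
          simp only [sq]
  have hslack : slack (u, -(U * D * Vᵀ)) = U * diagonal (fun i => u * (1 - t i ^ 2)) * Uᵀ := by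
    have h1 : u • (1 : Matrix (Fin n) (Fin n) ℝ) = U * diagonal (fun _ => u) * Uᵀ := by
      rw [← smul_one_eq_diagonal, Matrix.mul_smul, Matrix.smul_mul, Matrix.mul_one, hU']
    rw [slack]
    simp only [hWW]
    rw [h1, ← Matrix.smul_mul, ← Matrix.mul_smul, ← Matrix.sub_mul, ← Matrix.mul_sub,
      ← diagonal_smul, diagonal_sub]
    congr 3
    funext i
    simp only [Pi.smul_apply, smul_eq_mul]
    field_simp
  have hinv : (slack (u, -(U * D * Vᵀ)))⁻¹ =
      U * diagonal (fun i => (u * (1 - t i ^ 2))⁻¹) * Uᵀ := by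
    apply inv_eq_right_inv
    rw [hslack]
    calc _ = U * diagonal (fun i => u * (1 - t i ^ 2)) * (Uᵀ * U) *
          diagonal (fun i => (u * (1 - t i ^ 2))⁻¹) * Uᵀ := by simp only [Matrix.mul_assoc]
      _ = 1 := by
        rw [hU, Matrix.mul_one, Matrix.mul_assoc U, diagonal_mul_diagonal]
        have : (fun i => u * (1 - t i ^ 2) * (u * (1 - t i ^ 2))⁻¹) = fun _ => (1 : ℝ) := by
          funext i
          exact mul_inv_cancel₀ (mul_pos hu (hden i)).ne'
        rw [this, diagonal_one, Matrix.mul_one, hU']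
  have hprod : ∀ (a b : Fin n → ℝ) (k : ℕ) (X : Matrix (Fin n) (Fin k) ℝ),
      U * diagonal a * Uᵀ * (U * diagonal b * X) = U * diagonal (fun i => a i * b i) * X := by
    intro a b k X
    calc _ = U * diagonal a * (Uᵀ * U) * diagonal b * X := by simp only [Matrix.mul_assoc]
      _ = _ := by rw [hU, Matrix.mul_one, Matrix.mul_assoc U, diagonal_mul_diagonal]
  refine Prod.ext ?_ ?_
  · simp only [logDetGradient, hWW, hinv, hprod, trace_mul_diagonal_mul_transpose hU]
    rw [neg_inj, Finset.sum_div, ← Finset.sum_add_distrib]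
    have h1 : ∀ i, (u * (1 - t i ^ 2))⁻¹ + (u * (1 - t i ^ 2))⁻¹ * (u * t i) ^ 2 / u ^ 2 =
        √(1 + σ i ^ 2 * u ^ 2) / u := by
      intro i
      rw [← one_add_ratio_sq_div]
      have := hden i
      change _ = (1 + t i ^ 2) / (1 - t i ^ 2) / u
      field_simp
    simp only [h1]
    rw [← Finset.sum_div]
    field_simp
    linarith
  · simp only [logDetGradient, hinv, Matrix.mul_neg, smul_neg, hR]
    rw [neg_inj, hD, hprod, ← Matrix.smul_mul, ← Matrix.mul_smul, ← diagonal_smul]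
    congr 3
    funext i
    have h1 := two_mul_ratio_div u (σ i)
    have := hden i
    change 2 * t i / (1 - t i ^ 2) = σ i * u at h1
    simp only [Pi.smul_apply, smul_eq_mul]
    rw [div_eq_iff this.ne'] at h1
    field_simp
    linarith

end Gradient

/-! ### Cones, dual cones and convexity -/

section Cones

open scoped Matrix.Norms.L2Operator

variable {n m : ℕ}

/-- Tested against the point `(1, -U Vᵀ)` of the cone, membership in the interior of the dual cone
yields `p > ∑ i, σ i`. -/
theorem sum_lt_of_mem_interior_dualCone {p : ℝ} {R : Matrix (Fin n) (Fin m) ℝ}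
    {U : Matrix (Fin n) (Fin n) ℝ} {σ : Fin n → ℝ} {V : Matrix (Fin m) (Fin n) ℝ}
    (hsvd : IsSVD R U σ V)
    (hpR : (p, R) ∈ interior (dualCone (matInner n m) (spectralNormCone n m))) :
    ∑ i, σ i < p := by
  obtain ⟨ε, hε, h⟩ := exists_pos_sub_mem_of_mem_interior hpR
  obtain ⟨hU, hV, -, hR⟩ := hsvd
  have hmem : ((1 : ℝ), -(U * diagonal (1 : Fin n → ℝ) * Vᵀ)) ∈ spectralNormCone n m := by
    rw [spectralNormCone_eq, Set.mem_ofPred_eq, norm_neg]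
    refine (norm_mul_diagonal_mul_transpose_le hU hV _).trans ?_
    rw [pi_norm_le_iff_of_nonneg zero_le_one]; simp
  have h1 := h _ hmem
  have h2 : ((U * diagonal (1 : Fin n → ℝ) * Vᵀ)ᵀ * R).trace = ∑ i, σ i := by
    rw [← trace_diagonal σ]
    calc _ = (V * (Uᵀ * U) * diagonal σ * Vᵀ).trace := by
          rw [hR, transpose_mul, transpose_mul, transpose_transpose, diagonal_transpose,
            diagonal_one' , Matrix.one_mul]
          simp only [Matrix.mul_assoc]
      _ = (Vᵀ * V * diagonal σ).trace := by
          rw [hU, Matrix.mul_one, Matrix.trace_mul_comm, Matrix.mul_assoc]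
      _ = _ := by rw [hV, Matrix.one_mul]
  rw [matInner_apply, transpose_neg, Matrix.neg_mul, trace_neg, h2] at h1
  simp only at h1
  linarith

theorem mem_interior_dualCone_infNormCone {p : ℝ} {r : Fin n → ℝ} (h : ∑ i, |r i| < p) :
    (p, r) ∈ interior (dualCone (vecInner n) (infNormCone n)) := by
  have hopen : IsOpen {x : ℝ × (Fin n → ℝ) | ∑ i, |x.2 i| < x.1} :=
    isOpen_lt (by fun_prop) (by fun_prop)
  refine interior_maximal (fun x hx => ?_) hopen (Set.mem_ofPred_eq ▸ h)
  rw [Set.mem_ofPred_eq] at hx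
  intro w hw
  have hw' : ‖w.2‖ ≤ w.1 := hw
  have h1 : |w.2 ⬝ᵥ x.2| ≤ w.1 * ∑ i, |x.2 i| := by
    rw [dotProduct, Finset.mul_sum]
    refine (Finset.abs_sum_le_sum_abs _ _).trans (Finset.sum_le_sum fun i _ => ?_)
    rw [abs_mul]
    gcongr
    exact (norm_le_pi_norm w.2 i).trans hw'
  have h2 : w.1 * ∑ i, |x.2 i| ≤ w.1 * x.1 :=
    mul_le_mul_of_nonneg_left hx.le ((norm_nonneg _).trans hw')
  have h3 := neg_le_of_abs_le h1
  change 0 ≤ w.1 * x.1 + w.2 ⬝ᵥ x.2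
  linarith

theorem convex_infNormCone : Convex ℝ (infNormCone n) := convex_epigraph_norm

theorem interior_infNormCone : interior (infNormCone n) = {x | ‖x.2‖ < x.1} :=
  interior_epigraph_norm

theorem convexOn_spectralNormBarrier (h : n ≤ m) :
    ConvexOn ℝ (interior (spectralNormCone n m)) (spectralNormBarrier n m) := by
  refine convexOn_of_support ?_ (fun z => matInner n m (logDetGradient z)) ?_
  · rw [spectralNormCone_eq]; exact convex_epigraph_norm.interior
  · rw [interior_spectralNormCone]
    intro z hz x hx
    rw [spectralNormBarrier_eq h hz, spectralNormBarrier_eq h hx]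
    exact (logDetBarrier_support (mem_logDetDomain hz) (mem_logDetDomain hx)).1

/-! ### The infinity norm cone inside the spectral norm cone -/

/-- The embedding `(u, w) ↦ (u, Diag w)`, which pulls the inner product, the cone and the barrier
of the spectral norm cone of square matrices back to those of the infinity norm cone. -/
noncomputable def diagEmbedding (n : ℕ) :
    (ℝ × (Fin n → ℝ)) →ₗ[ℝ] ℝ × Matrix (Fin n) (Fin n) ℝ :=
  LinearMap.prodMap LinearMap.id (diagonalLinearMap (Fin n) ℝ ℝ)

theorem diagEmbedding_apply (x : ℝ × (Fin n → ℝ)) : diagEmbedding n x = (x.1, diagonal x.2) := rfl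

theorem diagEmbedding_injective : Function.Injective (diagEmbedding n) := by
  intro x y h
  rw [diagEmbedding_apply, diagEmbedding_apply, Prod.mk.injEq] at h
  exact Prod.ext h.1 (diagonal_injective h.2)

theorem matInner_diagEmbedding (x y : ℝ × (Fin n → ℝ)) :
    matInner n n (diagEmbedding n x) (diagEmbedding n y) = vecInner n x y := by
  rw [matInner_apply]
  change x.1 * y.1 + ((diagonal x.2)ᵀ * diagonal y.2).trace = x.1 * y.1 + x.2 ⬝ᵥ y.2
  rw [diagonal_transpose, diagonal_mul_diagonal, trace_diagonal]
  rfl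

theorem norm_diagEmbedding_lt {x : ℝ × (Fin n → ℝ)} (hx : ‖x.2‖ < x.1) :
    ‖(diagEmbedding n x).2‖ < (diagEmbedding n x).1 := by
  rw [diagEmbedding_apply, l2_opNorm_diagonal]
  exact hx

theorem infNormBarrier_eq {x : ℝ × (Fin n → ℝ)} (hx : ‖x.2‖ < x.1) :
    infNormBarrier n x = logDetBarrier (diagEmbedding n x) := by
  have hx0 : 0 < x.1 := (norm_nonneg _).trans_lt hx
  have hne : ∀ i, x.1 ^ 2 - x.2 i ^ 2 ≠ 0 := by
    intro i
    have : |x.2 i| < |x.1| := by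
      rw [abs_of_pos hx0]; exact (norm_le_pi_norm x.2 i).trans_lt hx
    have := sq_lt_sq.2 this
    linarith
  have hslack : slack (diagEmbedding n x) = diagonal fun i => x.1⁻¹ * (x.1 ^ 2 - x.2 i ^ 2) := by
    rw [slack, diagEmbedding_apply, diagonal_transpose, diagonal_mul_diagonal,
      smul_one_eq_diagonal, ← diagonal_smul, diagonal_sub]
    congr 1
    funext i
    simp only [Pi.smul_apply, smul_eq_mul]
    field_simp
  rw [logDetBarrier, hslack, det_diagonal, Real.log_prod fun i _ =>
    mul_ne_zero (inv_ne_zero hx0.ne') (hne i)]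
  simp only [fun i => Real.log_mul (inv_ne_zero hx0.ne') (hne i), Real.log_inv,
    Finset.sum_add_distrib, Finset.sum_const, Finset.card_univ, Fintype.card_fin, nsmul_eq_mul]
  rw [infNormBarrier, diagEmbedding_apply]
  ring

theorem convexOn_infNormBarrier :
    ConvexOn ℝ (interior (infNormCone n)) (infNormBarrier n) := by
  refine convexOn_of_support convex_infNormCone.interior
    (fun z => matInner n n (logDetGradient (diagEmbedding n z)) ∘ₗ diagEmbedding n) ?_
  rw [interior_infNormCone]
  intro z hz x hx
  rw [infNormBarrier_eq hz, infNormBarrier_eq hx]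
  exact (logDetBarrier_support (mem_logDetDomain (norm_diagEmbedding_lt hz))
    (mem_logDetDomain (norm_diagEmbedding_lt hx))).1

/-! ### The conjugate gradients -/

section Maximizer

variable {p : ℝ} {R : Matrix (Fin n) (Fin m) ℝ} {U : Matrix (Fin n) (Fin n) ℝ} {σ : Fin n → ℝ}
  {V : Matrix (Fin m) (Fin n) ℝ} {u : ℝ}

theorem norm_mul_ratio_lt (hu : 0 < u) (hσ : ∀ i, 0 ≤ σ i) :
    ‖fun i => u * ratio u (σ i)‖ < u := by
  rw [pi_norm_lt_iff hu]
  intro i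
  rw [Real.norm_of_nonneg (mul_nonneg hu.le (ratio_nonneg hu (hσ i)))]
  exact mul_lt_of_lt_one_right hu (ratio_lt_one u (σ i))

theorem norm_maximizer_lt (hsvd : IsSVD R U σ V) (hu : 0 < u) :
    ‖-(U * diagonal (fun i => u * ratio u (σ i)) * Vᵀ)‖ < u := by
  rw [norm_neg]
  exact (norm_mul_diagonal_mul_transpose_le hsvd.orthogonal hsvd.orthonormal _).trans_lt
    (norm_mul_ratio_lt hu hsvd.nonneg)

/-- The claimed maximiser `z` is the unique one: the gradient of the barrier at `z` is `-(p, R)`,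
so this is the strict support inequality at `z`. -/
theorem lt_maximizer (hsvd : IsSVD R U σ V) (hu : 0 < u)
    (hroot : p * u - ∑ i, √(1 + σ i ^ 2 * u ^ 2) - 1 = 0)
    {z : ℝ × Matrix (Fin n) (Fin m) ℝ}
    (hz : z = (u, -(U * diagonal (fun i => u * ratio u (σ i)) * Vᵀ)))
    {x : ℝ × Matrix (Fin n) (Fin m) ℝ} (hx : ‖x.2‖ < x.1) (hxz : x ≠ z) :
    -(matInner n m (p, R) x) - logDetBarrier x < -(matInner n m (p, R) z) - logDetBarrier z := by
  have hzn : ‖z.2‖ < z.1 := by rw [hz]; exact norm_maximizer_lt hsvd hu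
  have h1 := (logDetBarrier_support (mem_logDetDomain hzn) (mem_logDetDomain hx)).2 hxz
  have h2 : logDetGradient z = -(p, R) := by rw [hz, logDetGradient_eq hsvd hu hroot]; rfl
  rw [h2, map_neg, LinearMap.neg_apply, LinearMap.neg_apply] at h1
  linarith

theorem isConjugateGradient_spectralNormBarrier (h : n ≤ m) (hsvd : IsSVD R U σ V) (hu : 0 < u)
    (hroot : p * u - ∑ i, √(1 + σ i ^ 2 * u ^ 2) - 1 = 0) :
    IsConjugateGradient (matInner n m) (spectralNormCone n m) (spectralNormBarrier n m) (p, R)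
      (-u, U * diagonal (fun i => u * ratio u (σ i)) * Vᵀ) := by
  set z : ℝ × Matrix (Fin n) (Fin m) ℝ :=
    (u, -(U * diagonal (fun i => u * ratio u (σ i)) * Vᵀ)) with hzdef
  have hz : -(-u, U * diagonal (fun i => u * ratio u (σ i)) * Vᵀ) = z := by
    rw [Prod.neg_mk, neg_neg]
  have hzn : ‖z.2‖ < z.1 := norm_maximizer_lt hsvd hu
  refine IsConjugateGradient.of_unique_maximizer matInner_comm
    (convexOn_spectralNormBarrier h) ?_ ?_
  · rw [interior_spectralNormCone, hz]
    exact hzn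
  · intro w hw hne
    rw [interior_spectralNormCone, Set.mem_ofPred_eq] at hw
    rw [hz] at hne ⊢
    rw [spectralNormBarrier_eq h hw, spectralNormBarrier_eq h hzn]
    exact lt_maximizer hsvd hu hroot hzdef hw hne

theorem isConjugateGradient_infNormBarrier (hσ : ∀ i, 0 ≤ σ i) (hu : 0 < u)
    (hroot : p * u - ∑ i, √(1 + σ i ^ 2 * u ^ 2) - 1 = 0) :
    IsConjugateGradient (vecInner n) (infNormCone n) (infNormBarrier n) (p, σ)
      (-u, fun i => u * ratio u (σ i)) := by
  have hsvd : IsSVD (diagonal σ) 1 σ 1 := ⟨by simp, by simp, hσ, by simp⟩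
  set z : ℝ × (Fin n → ℝ) := (u, -fun i => u * ratio u (σ i)) with hzdef
  have hz : -(-u, fun i => u * ratio u (σ i)) = z := by
    rw [Prod.neg_mk, neg_neg]
  have hzn : ‖z.2‖ < z.1 := by
    rw [hzdef, norm_neg]
    exact norm_mul_ratio_lt hu hσ
  have hdz : diagEmbedding n z = (u, -(1 * diagonal (fun i => u * ratio u (σ i)) * 1ᵀ)) := by
    rw [diagEmbedding_apply, hzdef, transpose_one, Matrix.mul_one, Matrix.one_mul, diagonal_neg]
    rfl
  refine IsConjugateGradient.of_unique_maximizer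
    (fun x y => by rw [← matInner_diagEmbedding, matInner_comm, matInner_diagEmbedding])
    convexOn_infNormBarrier ?_ ?_
  · rw [interior_infNormCone, hz]
    exact hzn
  · intro w hw hne
    rw [interior_infNormCone, Set.mem_ofPred_eq] at hw
    rw [hz] at hne ⊢
    rw [infNormBarrier_eq hw, infNormBarrier_eq hzn, ← matInner_diagEmbedding,
      ← matInner_diagEmbedding]
    exact lt_maximizer hsvd hu hroot hdz (norm_diagEmbedding_lt hw)
      (diagEmbedding_injective.ne hne)

end Maximizer

end Cones

end ConjGrad

theorem mainTheorem7 (d₁ d₂ : ℕ) (hd : d₁ ≤ d₂) (p : ℝ) (R : Matrix (Fin d₁) (Fin d₂) ℝ)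
    (hpR : (p, R) ∈ interior
      (ConjGrad.dualCone (ConjGrad.matInner d₁ d₂) (ConjGrad.spectralNormCone d₁ d₂)))
    (U : Matrix (Fin d₁) (Fin d₁) ℝ) (σ : Fin d₁ → ℝ) (V : Matrix (Fin d₂) (Fin d₁) ℝ)
    (hsvd : ConjGrad.IsSVD R U σ V) :
    (p, σ) ∈ interior
      (ConjGrad.dualCone (ConjGrad.vecInner d₁) (ConjGrad.infNormCone d₁)) ∧
    ∃ (gp : ℝ) (gr : Fin d₁ → ℝ),
      (∀ y : ℝ, (y < 0 ∧ p * y + ∑ i, √(1 + σ i ^ 2 * y ^ 2) + 1 = 0) ↔ y = gp) ∧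
      (∀ i, gr i = if σ i ≠ 0 then (√(1 + gp ^ 2 * σ i ^ 2) - 1) / σ i else 0) ∧
      ConjGrad.IsConjugateGradient (ConjGrad.vecInner d₁) (ConjGrad.infNormCone d₁)
        (ConjGrad.infNormBarrier d₁) (p, σ) (gp, gr) ∧
      ConjGrad.IsConjugateGradient (ConjGrad.matInner d₁ d₂) (ConjGrad.spectralNormCone d₁ d₂)
        (ConjGrad.spectralNormBarrier d₁ d₂) (p, R) (gp, U * Matrix.diagonal gr * Vᵀ) := by
  have hp := ConjGrad.sum_lt_of_mem_interior_dualCone hsvd hpR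
  obtain ⟨u, hu, hroot, huniq⟩ := ConjGrad.exists_unique_pos_root hsvd.nonneg hp
  refine ⟨ConjGrad.mem_interior_dualCone_infNormCone ?_, -u,
    fun i => u * ConjGrad.ratio u (σ i), fun y => ⟨?_, ?_⟩, fun i => ?_,
    ConjGrad.isConjugateGradient_infNormBarrier hsvd.nonneg hu hroot,
    ConjGrad.isConjugateGradient_spectralNormBarrier hd hsvd hu hroot⟩
  · simpa only [fun i => abs_of_nonneg (hsvd.nonneg i)] using hp
  · rintro ⟨hy, hy0⟩
    rw [← huniq (-y) (neg_pos.2 hy) (by rw [neg_sq]; linarith), neg_neg]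
  · rintro rfl
    exact ⟨neg_lt_zero.2 hu, by rw [neg_sq]; linarith⟩
  · rw [neg_sq]
    split_ifs with hi
    · exact ConjGrad.mul_ratio hi
    · change u * ConjGrad.ratio u (σ i) = 0
      rw [not_not.1 hi, ConjGrad.ratio, zero_mul, zero_div, mul_zero]
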